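/- Let $\Lambda$ and $\Upsilon$ be sets, let $(E_\lambda)_{\lambda\in\Lambda}$ and $(F_\upsilon)_{\upsilon\in\Upsilon}$ be families of Banach spaces over the same scalar field ($\mathbb R$ or $\mathbb C$), and let $p=0$ or $1<p<\infty$. For $1<p<\infty$ write $(\bigoplus_{\lambda}E_\lambda)_p$ for the $\ell_p$-direct sum, and write $(\bigoplus_{\lambda}E_\lambda)_0$ for the $c_0$-direct sum. Let $T:(\bigoplus_{\lambda\in\Lambda}E_\lambda)_p\to(\bigoplus_{\upsilon\in\Upsilon}F_\upsilon)_p$ be a bounded linear operator and $\alpha>0$ an ordinal. For a nonempty finite set $\mathcal F\subseteq\Lambda$ let $U_{\mathcal F}:(\bigoplus_{\lambda\in\mathcal F}E_\lambda)_p\to(\bigoplus_{\lambda\in\Lambda}E_\lambda)_p$ be the canonical injection (extension by zero), and for a nonempty finite set $\mathcal G\subseteq\Upsilon$ let $Q_{\mathcal G}:(\bigoplus_{\upsilon\in\Upsilon}F_\upsilon)_p\to(\bigoplus_{\upsilon\in\mathcal G}F_\upsilon)_p$ be the canonical surjection (restriction). Szlenk indices are defined as follows. For a Banach space $E$, a $w^*$-compact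 set $K\subseteq E^*$ and $\varepsilon>0$, put $$s_\varepsilon(K)=\{x\in K : \operatorname{diam}(K\cap V)>\varepsilon\text{ for every } w^*\text{-open } V\ni x\},$$ where the diameter is taken in the dual norm. Put $s^0_\varepsilon(K)=K$, $s^{\beta+1}_\varepsilon(K)=s_\varepsilon(s^\beta_\varepsilon(K))$ for every ordinal $\beta$, and $s^\beta_\varepsilon(K)=\bigcap_{\gamma<\beta}s^\gamma_\varepsilon(K)$ for every limit ordinal $\beta$. Let $\mathrm{Sz}_\varepsilon(K)$ be the least ordinal $\beta$ with $s^\beta_\varepsilon(K)=\emptyset$, or $\infty$ if there is none, and let $\mathrm{Sz}(K)=\sup_{\varepsilon>0}\mathrm{Sz}_\varepsilon(K)$. For a bounded linear operator $S:E\to F$ between Banach spaces, with $B_{F^*}$ the closed unit ball of $F^*$, put $\mathrm{Sz}_\varepsilon(S)=\mathrm{Sz}_\varepsilon(S^*B_{F^*})$ and $\mathrm{Sz}(S)=\mathrm{Sz}(S^*B_{F^*})$. Then the following are equivalent: (i) $\mathrm{Sz}(T)\le\omega^\alpha$. (ii) For every $\varepsilon>0$, $\ \sup\{\mathrm{Sz}_\varepsilon(TU_{\mathcal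 F}) : \emptyset\ne\mathcal F\subseteq\Lambda\text{ finite}\}<\omega^\alpha$. (iii) For every $\varepsilon>0$, $\ \sup\{\mathrm{Sz}_\varepsilon(Q_{\mathcal G}T) : \emptyset\ne\mathcal G\subseteq\Upsilon\text{ finite}\}<\omega^\alpha$. (iv) For every $\varepsilon>0$, $\ \sup\{\mathrm{Sz}_\varepsilon(Q_{\mathcal G}TU_{\mathcal F}) : \emptyset\ne\mathcal F\subseteq\Lambda,\ \emptyset\ne\mathcal G\subseteq\Upsilon\text{ finite}\}<\omega^\alpha$. -/

import Mathlib

open Filter Topology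
open scoped ENNReal

noncomputable section

namespace Szlenk

/-! ### The Szlenk index -/

section Index

variable {𝕜 : Type*} [RCLike 𝕜] {X Y : Type*} [NormedAddCommGroup X] [NormedSpace 𝕜 X]
  [NormedAddCommGroup Y] [NormedSpace 𝕜 Y]

/-- The `ε`-Szlenk derivation of a set `K` in the dual of `X`: those `x ∈ K` such that
`diam (K ∩ V) > ε` for every weak-star open `V` containing `x`. The diameter is the (extended)
diameter in the dual norm. -/
def szDeriv (ε : ℝ) (K : Set (StrongDual 𝕜 X)) : Set (StrongDual 𝕜 X) :=
  {x | x ∈ K ∧ ∀ V : Set (WeakDual 𝕜 X), IsOpen V → StrongDual.toWeakDual x ∈ V →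
    ENNReal.ofReal ε < Metric.ediam (K ∩ StrongDual.toWeakDual ⁻¹' V)}

/-- The transfinite iterates of the `ε`-Szlenk derivation: the `0`-th is `K`, the `(β + 1)`-st is
the derivation of the `β`-th, and at limit ordinals one takes intersections. -/
def szDerivIter (ε : ℝ) (K : Set (StrongDual 𝕜 X)) (β : Ordinal) : Set (StrongDual 𝕜 X) :=
  Ordinal.limitRecOn (motive := fun _ => Set (StrongDual 𝕜 X)) β K
    (fun _ S => szDeriv ε S) (fun β _ S => ⋂ (γ : Ordinal) (h : γ < β), S γ h)

theorem szDerivIter_zero (ε : ℝ) (K : Set (StrongDual 𝕜 X)) : szDerivIter ε K 0 = K :=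
  Ordinal.limitRecOn_zero ..

theorem szDerivIter_add_one (ε : ℝ) (K : Set (StrongDual 𝕜 X)) (β : Ordinal) :
    szDerivIter ε K (β + 1) = szDeriv ε (szDerivIter ε K β) :=
  Ordinal.limitRecOn_add_one ..

theorem szDerivIter_limit (ε : ℝ) (K : Set (StrongDual 𝕜 X)) (β : Ordinal)
    (hβ : Order.IsSuccLimit β) :
    szDerivIter ε K β = ⋂ (γ : Ordinal) (_ : γ < β), szDerivIter ε K γ :=
  Ordinal.limitRecOn_limit _ _ _ _ hβ

/-- The `ε`-Szlenk index of `K`. The ordinals `β` with `szDerivIter ε K β ≠ ∅` form an initial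
segment; the index is the ordinal it represents, i.e. the least `β` with `szDerivIter ε K β = ∅`,
and it is `⊤` (that is, `∞`) if there is no such `β`. -/
def epsIndex (ε : ℝ) (K : Set (StrongDual 𝕜 X)) : WithTop Ordinal :=
  sInf ((fun β : Ordinal => (β : WithTop Ordinal)) '' {β | szDerivIter ε K β = ∅})

/-- The Szlenk index of `K`: the union (supremum) of the `ε`-Szlenk indices over `ε > 0`. -/
def index (K : Set (StrongDual 𝕜 X)) : WithTop Ordinal :=
  ⨆ (ε : ℝ) (_ : 0 < ε), epsIndex ε K

/-- The image of the closed unit ball of the dual of `Y` under the adjoint of `T : X → Y`. -/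
def adjointBall (T : X →L[𝕜] Y) : Set (StrongDual 𝕜 X) :=
  (fun f : StrongDual 𝕜 Y => f ∘L T) '' Metric.closedBall 0 1

/-- The `ε`-Szlenk index of an operator. -/
def opEpsIndex (ε : ℝ) (T : X →L[𝕜] Y) : WithTop Ordinal :=
  epsIndex ε (adjointBall T)

/-- The Szlenk index of an operator. -/
def opIndex (T : X →L[𝕜] Y) : WithTop Ordinal :=
  index (adjointBall T)

end Index

/-! ### Direct sums -/

section Sums

variable (𝕜 : Type*) [RCLike 𝕜] {ι : Type*} (E : ι → Type*)
  [∀ i, NormedAddCommGroup (E i)] [∀ i, NormedSpace 𝕜 (E i)]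
  (p : ℝ≥0∞) [Fact (1 ≤ p)]

/-- The direct sum of the family `E`: for `p = ∞` it is the `c₀`-direct sum (the families whose
norms vanish at infinity, with the supremum norm), and for `1 ≤ p < ∞` it is the full `ℓ_p`-direct
sum, because there the condition on the norms is automatic (see `directSum_eq_top`). -/
def directSum : Submodule 𝕜 (lp E p) where
  carrier := {x | Tendsto (fun i => ‖x i‖) cofinite (𝓝 0)}
  zero_mem' := by
    simpa using (tendsto_const_nhds : Tendsto (fun _ : ι => (0 : ℝ)) cofinite (𝓝 0))
  add_mem' := by
    intro x y hx hy
    have h := Tendsto.add hx hy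
    rw [add_zero] at h
    exact squeeze_zero (fun _ => norm_nonneg _) (fun i => norm_add_le (x i) (y i)) h
  smul_mem' := by
    intro c x hx
    have h := Tendsto.const_mul ‖c‖ hx
    rw [mul_zero] at h
    exact squeeze_zero (fun _ => norm_nonneg _) (fun i => norm_smul_le c (x i)) h

variable {E p}

/-- For finite `p`, `directSum 𝕜 E p` is the whole `ℓ_p`-direct sum. -/
theorem directSum_eq_top (hp : p ≠ ∞) : directSum 𝕜 E p = ⊤ := by
  have h0 : 0 < p.toReal :=
    ENNReal.toReal_pos (zero_lt_one.trans_le (Fact.out : 1 ≤ p)).ne' hp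
  rw [eq_top_iff]
  intro x _
  have h := ((lp.memℓp x).summable h0).tendsto_cofinite_zero
  have h2 := h.rpow_const (p := 1 / p.toReal) (Or.inr (by positivity))
  rw [Real.zero_rpow (by positivity)] at h2
  refine h2.congr fun i => ?_
  rw [← Real.rpow_mul (norm_nonneg _), mul_one_div_cancel h0.ne', Real.rpow_one]

open Classical in
/-- Extension by zero of a family indexed by a subset `R`. -/
def extendZero (R : Set ι) (x : ∀ i : R, E i) (i : ι) : E i :=
  if h : i ∈ R then x ⟨i, h⟩ else 0

theorem extendZero_val (R : Set ι) (x : ∀ i : R, E i) (i : R) : extendZero R x i = x i :=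
  dif_pos i.2

theorem extendZero_of_notMem (R : Set ι) (x : ∀ i : R, E i) {i : ι} (h : i ∉ R) :
    extendZero R x i = 0 :=
  dif_neg h

theorem extendZero_add (R : Set ι) (x y : ∀ i : R, E i) (i : ι) :
    extendZero R (fun j => x j + y j) i = extendZero R x i + extendZero R y i := by
  by_cases h : i ∈ R <;> simp [extendZero, h]

theorem extendZero_smul (R : Set ι) (c : 𝕜) (x : ∀ i : R, E i) (i : ι) :
    extendZero R (fun j => c • x j) i = c • extendZero R x i := by
  by_cases h : i ∈ R <;> simp [extendZero, h]

theorem norm_extendZero_le (R : Set ι) (x : lp (fun i : R => E i) p) (i : ι) :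
    ‖extendZero R (x : ∀ i : R, E i) i‖ ≤ ‖x‖ := by
  by_cases h : i ∈ R
  · rw [extendZero_val R _ ⟨i, h⟩]
    exact lp.norm_apply_le_norm (zero_lt_one.trans_le (Fact.out : 1 ≤ p)).ne' x ⟨i, h⟩
  · rw [extendZero_of_notMem R _ h, norm_zero]
    exact norm_nonneg _

set_option linter.unusedSectionVars false in
theorem hasSum_extendZero (hp : 0 < p.toReal) (R : Set ι) (x : lp (fun i : R => E i) p) :
    HasSum (fun i => ‖extendZero R (x : ∀ i : R, E i) i‖ ^ p.toReal) (‖x‖ ^ p.toReal) := by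
  refine (Function.Injective.hasSum_iff (g := ((↑) : R → ι)) Subtype.val_injective ?_).1 ?_
  · intro i hi
    rw [extendZero_of_notMem R _ (by simpa using hi), norm_zero, Real.zero_rpow hp.ne']
  · have h : (fun i => ‖extendZero R (x : ∀ i : R, E i) i‖ ^ p.toReal) ∘ ((↑) : R → ι) =
        fun i : R => ‖x i‖ ^ p.toReal := by
      funext i
      simp only [Function.comp_apply, extendZero_val]
    rw [h]
    exact lp.hasSum_norm hp x

theorem memℓp_extendZero (R : Set ι) (x : lp (fun i : R => E i) p) :
    Memℓp (extendZero R (x : ∀ i : R, E i)) p := by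
  by_cases hp : p = ∞
  · subst hp
    refine memℓp_infty ⟨‖x‖, ?_⟩
    rintro _ ⟨i, rfl⟩
    exact norm_extendZero_le R x i
  · have h0 : 0 < p.toReal :=
      ENNReal.toReal_pos (zero_lt_one.trans_le (Fact.out : 1 ≤ p)).ne' hp
    exact memℓp_gen (hasSum_extendZero h0 R x).summable

theorem norm_mk_extendZero_le (R : Set ι) (x : lp (fun i : R => E i) p) :
    ‖(⟨extendZero R (x : ∀ i : R, E i), memℓp_extendZero R x⟩ : lp E p)‖ ≤ ‖x‖ := by
  by_cases hp : p = ∞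
  · subst hp
    exact lp.norm_le_of_forall_le (norm_nonneg _) (norm_extendZero_le R x)
  · have h0 : 0 < p.toReal :=
      ENNReal.toReal_pos (zero_lt_one.trans_le (Fact.out : 1 ≤ p)).ne' hp
    exact lp.norm_le_of_tsum_le h0 (norm_nonneg _) (hasSum_extendZero h0 R x).tsum_eq.le

theorem tendsto_extendZero (R : Set ι) (x : ∀ i : R, E i)
    (hx : Tendsto (fun i => ‖x i‖) cofinite (𝓝 0)) :
    Tendsto (fun i => ‖extendZero R x i‖) cofinite (𝓝 0) := by
  rw [Metric.tendsto_nhds] at hx ⊢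
  intro ε hε
  have h := hx ε hε
  rw [eventually_cofinite] at h ⊢
  refine (h.image Subtype.val).subset fun i hi => ?_
  by_cases hR : i ∈ R
  · refine ⟨⟨i, hR⟩, ?_, rfl⟩
    rwa [Set.mem_ofPred_eq, extendZero_val R x ⟨i, hR⟩] at hi
  · rw [Set.mem_ofPred_eq, extendZero_of_notMem R x hR] at hi
    simp [hε] at hi

theorem memℓp_restrict (R : Set ι) (x : lp E p) : Memℓp (fun i : R => x i) p := by
  by_cases hp : p = ∞
  · subst hp
    refine memℓp_infty ⟨‖x‖, ?_⟩
    rintro _ ⟨i, rfl⟩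
    exact lp.norm_apply_le_norm ENNReal.top_ne_zero x i
  · have h0 : 0 < p.toReal :=
      ENNReal.toReal_pos (zero_lt_one.trans_le (Fact.out : 1 ≤ p)).ne' hp
    exact memℓp_gen (((lp.memℓp x).summable h0).comp_injective Subtype.val_injective)

theorem norm_mk_restrict_le (R : Set ι) (x : lp E p) :
    ‖(⟨fun i : R => x i, memℓp_restrict R x⟩ : lp (fun i : R => E i) p)‖ ≤ ‖x‖ := by
  by_cases hp : p = ∞
  · subst hp
    exact lp.norm_le_of_forall_le (norm_nonneg _)
      fun i => lp.norm_apply_le_norm ENNReal.top_ne_zero x i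
  · have h0 : 0 < p.toReal :=
      ENNReal.toReal_pos (zero_lt_one.trans_le (Fact.out : 1 ≤ p)).ne' hp
    refine lp.norm_le_of_tsum_le h0 (norm_nonneg _) ?_
    rw [lp.norm_rpow_eq_tsum h0]
    exact Summable.tsum_subtype_le (fun i => ‖x i‖ ^ p.toReal) R (fun i => by positivity)
      ((lp.memℓp x).summable h0)

variable (E p)

/-- The canonical injection of the direct sum over a subset `R` of the index set into the whole
direct sum (extension by zero). -/
def inj (R : Set ι) : directSum 𝕜 (fun i : R => E i) p →L[𝕜] directSum 𝕜 E p :=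
  LinearMap.mkContinuous
    { toFun := fun x => ⟨⟨extendZero R (x.1 : ∀ i : R, E i), memℓp_extendZero R x.1⟩,
        tendsto_extendZero R _ x.2⟩
      map_add' := fun x y => Subtype.ext <| Subtype.ext <| funext fun i =>
        extendZero_add R (fun j => x.1 j) (fun j => y.1 j) i
      map_smul' := fun c x => Subtype.ext <| Subtype.ext <| funext fun i =>
        extendZero_smul 𝕜 R c (fun j => x.1 j) i }
    1 fun x => by
      rw [one_mul]
      exact norm_mk_extendZero_le R x.1

/-- The canonical surjection of the whole direct sum onto the direct sum over a subset `R` of the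
index set (restriction of families). -/
def proj (R : Set ι) : directSum 𝕜 E p →L[𝕜] directSum 𝕜 (fun i : R => E i) p :=
  LinearMap.mkContinuous
    { toFun := fun x => ⟨⟨fun i : R => x.1 i, memℓp_restrict R x.1⟩,
        x.2.comp Subtype.val_injective.tendsto_cofinite⟩
      map_add' := fun _ _ => rfl
      map_smul' := fun _ _ => rfl }
    1 fun x => by
      rw [one_mul]
      exact norm_mk_restrict_le R x.1

end Sums

end Szlenk

end

/-! Composing with a projection or an injection costs at most a factor 2 in `ε`, so the substance
lies in passing from finite subsums back to the whole. The reason is asymptotic uniform smoothness: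
since `p > 1` (with `p = ∞` encoding the `c₀` case), adding a small disjointly supported vector of
norm `t` to a unit vector raises the norm by only `o(t)`. By duality, a functional of norm at most
`a` that nearly attains `a` on vectors supported in `R` is uniformly close to its truncation to `R`
(`exists_dualDist_truncate_le`).

Nearly attaining `a` at a fixed vector is a weak-star open condition, so near such functionals the
full derivation is controlled by the truncated one. If all finite truncations die within `β` steps,
then after `β` steps only functionals of norm at most `a - δ` survive
(`norm_le_of_mem_derivedIter`). As `δ` is uniform for `a ≤ r`, finitely many rounds exhaust the set
(`exists_derivedIter_mul_eq_empty`), and `β * n < ω ^ α` whenever `β < ω ^ α`.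

Derivations are set up for an arbitrary function `d`, so that the pulled-back distances `‖T* z - T*
w‖` of an operator and of its truncations can be compared on one and the same set. -/

namespace Szlenk

/-! ### Derivations of subsets of a topological space -/

section Derivation

variable {A B : Type*} [TopologicalSpace A] [TopologicalSpace B]

/-- The points `x` of `L` such that every neighbourhood of `x` contains two points of `L` at
distance greater than `ε`, distances being measured by `d`. -/
def derived (d : A → A → ℝ) (ε : ℝ) (L : Set A) : Set A :=
  {x | x ∈ L ∧ ∀ V, IsOpen V → x ∈ V → ∃ z ∈ L ∩ V, ∃ w ∈ L ∩ V, ε < d z w}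

/-- The transfinite iterates of `derived`. -/
noncomputable def derivedIter (d : A → A → ℝ) (ε : ℝ) (L : Set A) (β : Ordinal) : Set A :=
  Ordinal.limitRecOn (motive := fun _ => Set A) β L
    (fun _ S => derived d ε S) (fun β _ S => ⋂ (γ : Ordinal) (h : γ < β), S γ h)

variable (d : A → A → ℝ) (ε : ℝ) (L : Set A)

theorem derivedIter_zero : derivedIter d ε L 0 = L :=
  Ordinal.limitRecOn_zero ..

theorem derivedIter_add_one (β : Ordinal) :
    derivedIter d ε L (β + 1) = derived d ε (derivedIter d ε L β) :=
  Ordinal.limitRecOn_add_one ..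

theorem derivedIter_limit {β : Ordinal} (hβ : Order.IsSuccLimit β) :
    derivedIter d ε L β = ⋂ (γ : Ordinal) (_ : γ < β), derivedIter d ε L γ :=
  Ordinal.limitRecOn_limit _ _ _ _ hβ

theorem derived_subset : derived d ε L ⊆ L := fun _ hx => hx.1

theorem derivedIter_antitone : Antitone (derivedIter d ε L) := by
  intro γ β
  induction β using Ordinal.limitRecOn with
  | zero =>
    intro h
    rw [nonpos_iff_eq_zero.1 h]
  | add_one β ih =>
    intro h
    rcases h.eq_or_lt with rfl | h
    · exact le_rfl
    · rw [derivedIter_add_one]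
      exact (derived_subset _ _ _).trans (ih (Order.lt_add_one_iff.1 h))
  | limit β hβ ih =>
    intro h
    rcases h.eq_or_lt with rfl | h
    · exact le_rfl
    · rw [derivedIter_limit _ _ _ hβ]
      exact Set.iInter₂_subset γ h

theorem derivedIter_subset (β : Ordinal) : derivedIter d ε L β ⊆ L := by
  simpa only [derivedIter_zero] using derivedIter_antitone d ε L (zero_le (a := β))

theorem derivedIter_add (β γ : Ordinal) :
    derivedIter d ε L (β + γ) = derivedIter d ε (derivedIter d ε L β) γ := by
  induction γ using Ordinal.limitRecOn with
  | zero => rw [add_zero, derivedIter_zero]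
  | add_one γ ih => rw [← add_assoc, derivedIter_add_one, derivedIter_add_one, ih]
  | limit γ hγ ih =>
    rw [derivedIter_limit _ _ _ hγ, derivedIter_limit _ _ _ (Ordinal.isSuccLimit_add β hγ)]
    apply subset_antisymm
    · refine Set.subset_iInter₂ fun δ hδ => ?_
      rw [← ih δ hδ]
      exact Set.iInter₂_subset (β + δ) (by gcongr)
    · refine Set.subset_iInter₂ fun δ hδ => ?_
      rcases lt_or_ge δ β with h | h
      -- Stages before `β` contain the stage `β`, which is the term of index `0` in the
      -- intersection.
      · refine (Set.iInter₂_subset 0 hγ.bot_lt).trans ?_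
        rw [derivedIter_zero]
        exact derivedIter_antitone d ε L h.le
      · obtain ⟨η, rfl⟩ := exists_add_of_le h
        have hη : η < γ := by simpa using hδ
        rw [ih η hη]
        exact Set.iInter₂_subset η hη

variable {d ε L}

/-- If on `L ∩ V`, with `V` open, points which are far apart for `d` are far apart for `d'`, then on
`V` the derivation defined by `d` is faster than the one defined by `d'`. -/
theorem derivedIter_inter_subset {d' : A → A → ℝ} {ε' : ℝ} {L' V : Set A} (hV : IsOpen V)
    (hL : L ∩ V ⊆ L')
    (h : ∀ z ∈ L ∩ V, ∀ w ∈ L ∩ V, ε < d z w → ε' < d' z w) (β : Ordinal) :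
    derivedIter d ε L β ∩ V ⊆ derivedIter d' ε' L' β := by
  induction β using Ordinal.limitRecOn with
  | zero => simpa only [derivedIter_zero] using hL
  | add_one β ih =>
    rw [derivedIter_add_one, derivedIter_add_one]
    rintro x ⟨⟨hx, hd⟩, hxV⟩
    refine ⟨ih ⟨hx, hxV⟩, fun W hW hxW => ?_⟩
    -- Testing on `V ∩ W` keeps both witnesses in `V`, where the induction hypothesis and the
    -- comparison of distances apply.
    obtain ⟨z, ⟨hz, hzV, hzW⟩, w, ⟨hw, hwV, hwW⟩, hzw⟩ := hd (V ∩ W) (hV.inter hW) ⟨hxV, hxW⟩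
    exact ⟨z, ⟨ih ⟨hz, hzV⟩, hzW⟩, w, ⟨ih ⟨hw, hwV⟩, hwW⟩,
      h z ⟨derivedIter_subset _ _ _ _ hz, hzV⟩ w ⟨derivedIter_subset _ _ _ _ hw, hwV⟩ hzw⟩
  | limit β hβ ih =>
    rw [derivedIter_limit _ _ _ hβ, derivedIter_limit _ _ _ hβ]
    rintro x ⟨hx, hxV⟩
    simp only [Set.mem_iInter] at hx ⊢
    exact fun γ hγ => ih γ hγ ⟨hx γ hγ, hxV⟩

theorem derivedIter_subset_of_le {d' : A → A → ℝ} {ε' : ℝ} {L' : Set A} (hL : L ⊆ L')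
    (h : ∀ z ∈ L, ∀ w ∈ L, ε < d z w → ε' < d' z w) (β : Ordinal) :
    derivedIter d ε L β ⊆ derivedIter d' ε' L' β := by
  simpa only [Set.inter_univ] using
    derivedIter_inter_subset (V := Set.univ) isOpen_univ (by simpa using hL) (by simpa using h) β

theorem isClosed_derived (hL : IsClosed L) : IsClosed (derived d ε L) := by
  have h : derived d ε L =
      L ∩ (⋃₀ {V | IsOpen V ∧ ¬ ∃ z ∈ L ∩ V, ∃ w ∈ L ∩ V, ε < d z w})ᶜ := by
    ext x
    simp only [derived, Set.mem_ofPred_eq, Set.mem_inter_iff, Set.mem_compl_iff, Set.mem_sUnion]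
    constructor
    · rintro ⟨hx, h⟩
      exact ⟨hx, fun ⟨V, ⟨hV, hn⟩, hxV⟩ => hn (h V hV hxV)⟩
    · rintro ⟨hx, h⟩
      exact ⟨hx, fun V hV hxV => by_contra fun hn => h ⟨V, ⟨hV, hn⟩, hxV⟩⟩
  rw [h]
  exact hL.inter (isOpen_sUnion fun V hV => hV.1).isClosed_compl

theorem isClosed_derivedIter (hL : IsClosed L) (β : Ordinal) :
    IsClosed (derivedIter d ε L β) := by
  induction β using Ordinal.limitRecOn with
  | zero => rwa [derivedIter_zero]
  | add_one β ih =>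
    rw [derivedIter_add_one]
    exact isClosed_derived ih
  | limit β hβ ih =>
    rw [derivedIter_limit _ _ _ hβ]
    exact isClosed_biInter ih

theorem isCompact_derivedIter (hL : IsCompact L) (hL' : IsClosed L) (β : Ordinal) :
    IsCompact (derivedIter d ε L β) :=
  hL.of_isClosed_subset (isClosed_derivedIter hL' β) (derivedIter_subset _ _ _ _)

/-- Cantor's intersection theorem for the decreasing compact iterates. It serves with `C` the whole
space and with `C` a fibre of a continuous map. -/
theorem nonempty_derivedIter_limit_inter (hL : IsCompact L) (hL' : IsClosed L) {C : Set A}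
    (hC : IsClosed C) {β : Ordinal} (hβ : Order.IsSuccLimit β)
    (h : ∀ γ < β, (derivedIter d ε L γ ∩ C).Nonempty) :
    (derivedIter d ε L β ∩ C).Nonempty := by
  have : Nonempty (Set.Iio β) := ⟨⟨0, hβ.bot_lt⟩⟩
  have key := IsCompact.nonempty_iInter_of_directed_nonempty_isCompact_isClosed
    (fun γ : Set.Iio β => derivedIter d ε L γ ∩ C)
    (Antitone.directed_ge fun γ γ' hγ =>
      Set.inter_subset_inter_left _ (derivedIter_antitone d ε L hγ))
    (fun γ => h γ γ.2) (fun γ => (isCompact_derivedIter hL hL' _).inter_right hC)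
    (fun γ => (isClosed_derivedIter hL' _).inter hC)
  rw [← Set.iInter_inter] at key
  rw [derivedIter_limit _ _ _ hβ]
  convert key using 2
  ext x
  simp

theorem exists_lt_derivedIter_eq_empty (hL : IsCompact L) (hL' : IsClosed L)
    {β : Ordinal} (hβ : Order.IsSuccLimit β) (h : derivedIter d ε L β = ∅) :
    ∃ γ < β, derivedIter d ε L γ = ∅ := by
  by_contra! hne
  have := nonempty_derivedIter_limit_inter (d := d) (ε := ε) hL hL' isClosed_univ hβ
    (by simpa using hne)
  simp [h] at this

theorem mapsTo_derivedIter {f : A → B} (hf : Continuous f) {e : B → B → ℝ} {M : Set B}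
    (hLM : Set.MapsTo f L M) (β : Ordinal) :
    Set.MapsTo f (derivedIter (fun x y => e (f x) (f y)) ε L β) (derivedIter e ε M β) := by
  induction β using Ordinal.limitRecOn with
  | zero => simpa only [derivedIter_zero] using hLM
  | add_one β ih =>
    rw [derivedIter_add_one, derivedIter_add_one]
    rintro x ⟨hx, hd⟩
    refine ⟨ih hx, fun W hW hxW => ?_⟩
    obtain ⟨z, ⟨hz, hzW⟩, w, ⟨hw, hwW⟩, hzw⟩ := hd (f ⁻¹' W) (hW.preimage hf) hxW
    exact ⟨f z, ⟨ih hz, hzW⟩, f w, ⟨ih hw, hwW⟩, hzw⟩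
  | limit β hβ ih =>
    rw [derivedIter_limit _ _ _ hβ, derivedIter_limit _ _ _ hβ]
    intro x hx
    simp only [Set.mem_iInter] at hx ⊢
    exact fun γ hγ => ih γ hγ (hx γ hγ)

/-- If no preimage of `x` survives, finitely many open sets of small `e`-oscillation cover the
compact fibre over `x`. The image of the rest of `L` is closed and misses `x`, so near `x` every
point of `f '' L` is within `ε` of `x`. Two such points may come from different open sets, so they
are compared through `x`, which is where the factor 2 arises. -/
theorem derived_image_subset [T2Space B] {f : A → B} (hf : Continuous f)
    {e : B → B → ℝ} (he : ∀ x y, e x y = e y x) (he' : ∀ x y z, e x z ≤ e x y + e y z)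
    (hL : IsCompact L) :
    derived e (2 * ε) (f '' L) ⊆ f '' derived (fun x y => e (f x) (f y)) ε L := by
  rintro x ⟨hx, hd⟩
  by_contra hcon
  have hV : ∀ y ∈ L ∩ f ⁻¹' {x}, ∃ V, IsOpen V ∧ y ∈ V ∧
      ∀ z ∈ L ∩ V, ∀ w ∈ L ∩ V, e (f z) (f w) ≤ ε := by
    rintro y ⟨hy, hyx⟩
    by_contra! h
    exact hcon ⟨y, ⟨hy, fun V hV hyV => h V hV hyV⟩, hyx⟩
  choose! V hVo hyV hVd using hV
  have hcomp : IsCompact (L ∩ f ⁻¹' {x}) := hL.inter_right (isClosed_singleton.preimage hf)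
  obtain ⟨t, ht⟩ := hcomp.elim_nhds_subcover' (fun y _ => V y)
    (fun y hy => (hVo y hy).mem_nhds (hyV y hy))
  have hW : IsOpen (⋃ y ∈ t, V (y : A)) := isOpen_biUnion fun y _ => hVo y y.2
  have hclosed : IsClosed (f '' (L \ ⋃ y ∈ t, V (y : A))) := ((hL.diff hW).image hf).isClosed
  obtain ⟨z, ⟨⟨z, hz, rfl⟩, hzW⟩, w, ⟨⟨w, hw, rfl⟩, hwW⟩, hzw⟩ :=
    hd _ hclosed.isOpen_compl (by
      rintro ⟨y, ⟨hy, hyW⟩, hyx⟩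
      exact hyW (ht ⟨hy, hyx⟩))
  have hnear : ∀ z ∈ L, f z ∉ f '' (L \ ⋃ y ∈ t, V (y : A)) → e (f z) x ≤ ε := by
    intro z hz hzW
    have : z ∈ ⋃ y ∈ t, V (y : A) := by
      by_contra h
      exact hzW ⟨z, ⟨hz, h⟩, rfl⟩
    simp only [Set.mem_iUnion] at this
    obtain ⟨y, -, hzy⟩ := this
    have hyx : f y = x := y.2.2
    rw [← hyx]
    exact hVd y y.2 z ⟨hz, hzy⟩ y ⟨y.2.1, hyV y y.2⟩
  have h1 := hnear z hz hzW
  have h2 := hnear w hw hwW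
  rw [he] at h2
  linarith [he' (f z) x (f w)]

theorem derivedIter_image_subset [T2Space B] {f : A → B} (hf : Continuous f)
    {e : B → B → ℝ} (he : ∀ x y, e x y = e y x) (he' : ∀ x y z, e x z ≤ e x y + e y z)
    (hL : IsCompact L) (hL' : IsClosed L) (β : Ordinal) :
    derivedIter e (2 * ε) (f '' L) β ⊆ f '' derivedIter (fun x y => e (f x) (f y)) ε L β := by
  induction β using Ordinal.limitRecOn with
  | zero => simp only [derivedIter_zero, subset_rfl]
  | add_one β ih =>
    rw [derivedIter_add_one, derivedIter_add_one]
    refine subset_trans ?_ (derived_image_subset hf he he' (isCompact_derivedIter hL hL' β))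
    rintro x ⟨hx, hd⟩
    refine ⟨ih hx, fun V hV hxV => ?_⟩
    obtain ⟨z, hz, w, hw, h⟩ := hd V hV hxV
    exact ⟨z, ⟨ih hz.1, hz.2⟩, w, ⟨ih hw.1, hw.2⟩, h⟩
  | limit β hβ ih =>
    intro x hx
    rw [derivedIter_limit _ _ _ hβ] at hx
    simp only [Set.mem_iInter] at hx
    -- The preimages of `x` found at earlier stages may differ; compactness of the fibre yields one
    -- common to all stages.
    refine nonempty_derivedIter_limit_inter hL hL' (isClosed_singleton.preimage hf) hβ
      fun γ hγ => ?_
    exact ih γ hγ (hx γ hγ)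

end Derivation

/-! ### The Szlenk derivation as a derivation for the weak-star topology -/

section WeakStar

variable {𝕜 : Type*} [RCLike 𝕜] {X Y Z : Type*} [NormedAddCommGroup X] [NormedSpace 𝕜 X]
  [NormedAddCommGroup Y] [NormedSpace 𝕜 Y] [NormedAddCommGroup Z] [NormedSpace 𝕜 Z]

open WeakDual

/-- The dual norm distance on the weak-star dual. -/
noncomputable def dualDist (x y : WeakDual 𝕜 X) : ℝ := ‖toStrongDual x - toStrongDual y‖

theorem dualDist_nonneg (x y : WeakDual 𝕜 X) : 0 ≤ dualDist x y :=
  norm_nonneg _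

theorem dualDist_self (x : WeakDual 𝕜 X) : dualDist x x = 0 := by
  rw [dualDist, sub_self, norm_zero]

theorem dualDist_comm (x y : WeakDual 𝕜 X) : dualDist x y = dualDist y x :=
  norm_sub_rev _ _

theorem dualDist_triangle (x y z : WeakDual 𝕜 X) : dualDist x z ≤ dualDist x y + dualDist y z :=
  norm_sub_le_norm_sub_add_norm_sub _ _ _

/-- A supremum of distances exceeds `ε` exactly when some distance does. The sign of `ε` matters
because `ENNReal.ofReal` sends negative numbers to `0`. -/
theorem szDeriv_preimage {ε : ℝ} (hε : 0 ≤ ε) (K : Set (WeakDual 𝕜 X)) :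
    szDeriv ε (StrongDual.toWeakDual ⁻¹' K) = StrongDual.toWeakDual ⁻¹' derived dualDist ε K := by
  ext x
  refine and_congr_right fun _ => forall_congr' fun V => forall_congr' fun _ =>
    forall_congr' fun _ => ?_
  rw [← not_le, Metric.ediam_le_iff]
  push Not
  refine exists_congr fun z => and_congr_right fun _ => exists_congr fun w =>
    and_congr_right fun _ => ?_
  rw [edist_dist, ENNReal.ofReal_lt_ofReal_iff_of_nonneg hε, dist_eq_norm]
  rfl

theorem szDerivIter_preimage {ε : ℝ} (hε : 0 ≤ ε) (K : Set (WeakDual 𝕜 X)) (β : Ordinal) :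
    szDerivIter ε (StrongDual.toWeakDual ⁻¹' K) β =
      StrongDual.toWeakDual ⁻¹' derivedIter dualDist ε K β := by
  induction β using Ordinal.limitRecOn with
  | zero => rw [szDerivIter_zero, derivedIter_zero]
  | add_one β ih => rw [szDerivIter_add_one, derivedIter_add_one, ih, szDeriv_preimage hε]
  | limit β hβ ih =>
    rw [szDerivIter_limit _ _ _ hβ, derivedIter_limit _ _ _ hβ]
    simp only [Set.preimage_iInter]
    exact Set.iInter₂_congr ih

/-- The adjoint of an operator, as a map between weak-star duals. -/
noncomputable def weakAdjoint (T : X →L[𝕜] Y) (f : WeakDual 𝕜 Y) : WeakDual 𝕜 X :=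
  StrongDual.toWeakDual (toStrongDual f ∘L T)

theorem continuous_weakAdjoint (T : X →L[𝕜] Y) : Continuous (weakAdjoint T) :=
  WeakDual.continuous_of_continuous_eval fun x => WeakDual.eval_continuous (T x)

theorem dualDist_weakAdjoint_le (T : X →L[𝕜] Y) (f g : WeakDual 𝕜 Y) :
    dualDist (weakAdjoint T f) (weakAdjoint T g) ≤ ‖T‖ * dualDist f g := by
  have : toStrongDual (weakAdjoint T f) - toStrongDual (weakAdjoint T g) =
      (toStrongDual f - toStrongDual g) ∘L T := rfl
  rw [dualDist, this, mul_comm]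
  exact ContinuousLinearMap.opNorm_comp_le _ _

/-- The closed unit ball of the dual of `X`. -/
def dualBall (𝕜 X : Type*) [RCLike 𝕜] [NormedAddCommGroup X] [NormedSpace 𝕜 X] :
    Set (WeakDual 𝕜 X) :=
  toStrongDual ⁻¹' Metric.closedBall 0 1

theorem isCompact_dualBall : IsCompact (dualBall 𝕜 X) :=
  WeakDual.isCompact_closedBall 0 1

theorem mem_dualBall {f : WeakDual 𝕜 X} : f ∈ dualBall 𝕜 X ↔ ‖toStrongDual f‖ ≤ 1 := by
  rw [dualBall, Set.mem_preimage, mem_closedBall_zero_iff]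

theorem adjointBall_eq (T : X →L[𝕜] Y) :
    adjointBall T = StrongDual.toWeakDual ⁻¹' (weakAdjoint T '' dualBall 𝕜 Y) := rfl

theorem isCompact_weakAdjoint_image (T : X →L[𝕜] Y) :
    IsCompact (weakAdjoint T '' dualBall 𝕜 Y) :=
  isCompact_dualBall.image (continuous_weakAdjoint T)

theorem weakAdjoint_image_comp_subset (T : X →L[𝕜] Y) (S : Y →L[𝕜] Z) (hS : ‖S‖ ≤ 1) :
    weakAdjoint (S ∘L T) '' dualBall 𝕜 Z ⊆ weakAdjoint T '' dualBall 𝕜 Y := by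
  rintro _ ⟨f, hf, rfl⟩
  refine ⟨weakAdjoint S f, ?_, rfl⟩
  rw [mem_dualBall] at hf ⊢
  exact (ContinuousLinearMap.opNorm_comp_le _ _).trans (mul_le_one₀ hf (norm_nonneg _) hS)

theorem weakAdjoint_image_comp (T : X →L[𝕜] Y) (S : Y →L[𝕜] Z) :
    weakAdjoint (S ∘L T) '' dualBall 𝕜 Z = weakAdjoint T '' (weakAdjoint S '' dualBall 𝕜 Z) := by
  rw [Set.image_image]
  rfl

theorem szDerivIter_antitone (ε : ℝ) (hε : 0 ≤ ε) (K : Set (StrongDual 𝕜 X)) :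
    Antitone (szDerivIter ε K) := by
  intro γ β h
  have hK : K = StrongDual.toWeakDual ⁻¹' (toStrongDual ⁻¹' K) := rfl
  rw [hK, szDerivIter_preimage hε, szDerivIter_preimage hε]
  exact Set.preimage_mono (derivedIter_antitone _ _ _ h)

theorem epsIndex_le_iff {ε : ℝ} (hε : 0 ≤ ε) (K : Set (StrongDual 𝕜 X)) (β : Ordinal) :
    epsIndex ε K ≤ (β : WithTop Ordinal) ↔ szDerivIter ε K β = ∅ := by
  constructor
  · intro h
    rcases Set.eq_empty_or_nonempty {β : Ordinal | szDerivIter ε K β = ∅} with h0 | hne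
    · rw [epsIndex, h0, Set.image_empty, sInf_empty, top_le_iff] at h
      exact absurd h WithTop.coe_ne_top
    · obtain ⟨γ, hγ, hγ'⟩ := csInf_mem (hne.image (fun β : Ordinal => (β : WithTop Ordinal)))
      rw [epsIndex, ← hγ'] at h
      exact Set.subset_eq_empty (szDerivIter_antitone ε hε K (WithTop.coe_le_coe.1 h)) hγ
  · intro h
    exact sInf_le ⟨β, h, rfl⟩

theorem opEpsIndex_le_iff {ε : ℝ} (hε : 0 ≤ ε) (T : X →L[𝕜] Y) (β : Ordinal) :
    opEpsIndex ε T ≤ (β : WithTop Ordinal) ↔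
      derivedIter dualDist ε (weakAdjoint T '' dualBall 𝕜 Y) β = ∅ := by
  rw [opEpsIndex, epsIndex_le_iff hε, adjointBall_eq, szDerivIter_preimage hε]
  exact Set.preimage_eq_empty_iff.trans (by
    rw [StrongDual.toWeakDual.surjective.range_eq, Set.disjoint_univ])

theorem opEpsIndex_comp_left_le {ε : ℝ} (hε : 0 ≤ ε) (T : X →L[𝕜] Y) (S : Y →L[𝕜] Z)
    (hS : ‖S‖ ≤ 1) : opEpsIndex ε (S ∘L T) ≤ opEpsIndex ε T := by
  refine le_of_forall_ge fun b hb => ?_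
  induction b using WithTop.recTopCoe with
  | top => exact le_top
  | coe β =>
    rw [opEpsIndex_le_iff hε] at hb ⊢
    exact Set.subset_eq_empty (derivedIter_subset_of_le
      (weakAdjoint_image_comp_subset T S hS) (fun _ _ _ _ h => h) β) hb

/-- The adjoint ball of the composite is the image under `S*` of that of `T`, so the factor 2 of
`derivedIter_image_subset` appears; composition on the left merely shrinks the set and loses
nothing. -/
theorem opEpsIndex_comp_right_le {ε : ℝ} (hε : 0 ≤ ε) (T : X →L[𝕜] Y) (S : Z →L[𝕜] X)
    (hS : ‖S‖ ≤ 1) : opEpsIndex (2 * ε) (T ∘L S) ≤ opEpsIndex ε T := by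
  refine le_of_forall_ge fun b hb => ?_
  induction b using WithTop.recTopCoe with
  | top => exact le_top
  | coe β =>
    rw [opEpsIndex_le_iff hε] at hb
    rw [opEpsIndex_le_iff (by positivity), weakAdjoint_image_comp]
    have hK := isCompact_weakAdjoint_image T
    refine Set.subset_eq_empty (derivedIter_image_subset (continuous_weakAdjoint S)
      dualDist_comm dualDist_triangle hK hK.isClosed β) ?_
    rw [Set.image_eq_empty]
    refine Set.subset_eq_empty (derivedIter_subset_of_le subset_rfl (fun z _ w _ h => ?_) β) hb
    refine h.trans_le ((dualDist_weakAdjoint_le S z w).trans ?_)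
    exact mul_le_of_le_one_left (norm_nonneg _) hS

/-- The inequality becomes strict because, by compactness, the iterates cannot become empty for the
first time at a limit stage. -/
theorem opEpsIndex_lt_of_opIndex_le {ε : ℝ} (hε : 0 < ε) (T : X →L[𝕜] Y) {β : Ordinal}
    (hβ : Order.IsSuccLimit β) (h : opIndex T ≤ (β : WithTop Ordinal)) :
    opEpsIndex ε T < (β : WithTop Ordinal) := by
  have h1 : opEpsIndex ε T ≤ (β : WithTop Ordinal) :=
    (le_iSup₂ (f := fun (ε : ℝ) (_ : 0 < ε) => epsIndex ε (adjointBall T)) ε hε).trans h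
  rw [opEpsIndex_le_iff hε.le] at h1
  have hK := isCompact_weakAdjoint_image T
  obtain ⟨γ, hγ, h2⟩ := exists_lt_derivedIter_eq_empty hK hK.isClosed hβ h1
  exact ((opEpsIndex_le_iff hε.le T γ).2 h2).trans_lt (WithTop.coe_lt_coe.2 hγ)

end WeakStar

/-! ### Truncation in direct sums -/

section Truncation

variable (𝕜 : Type*) [RCLike 𝕜] {ι : Type*} (E : ι → Type*)
  [∀ i, NormedAddCommGroup (E i)] [∀ i, NormedSpace 𝕜 (E i)]
  (p : ℝ≥0∞) [Fact (1 ≤ p)]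

theorem norm_inj_le (R : Set ι) : ‖inj 𝕜 E p R‖ ≤ 1 :=
  LinearMap.mkContinuous_norm_le _ zero_le_one _

theorem norm_proj_le (R : Set ι) : ‖proj 𝕜 E p R‖ ≤ 1 :=
  LinearMap.mkContinuous_norm_le _ zero_le_one _

/-- The projection of a direct sum onto the families supported in `R`. -/
noncomputable def truncate (R : Set ι) : directSum 𝕜 E p →L[𝕜] directSum 𝕜 E p :=
  inj 𝕜 E p R ∘L proj 𝕜 E p R

variable {E p}

theorem truncate_apply_of_mem {R : Set ι} (x : directSum 𝕜 E p) {i : ι} (hi : i ∈ R) :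
    (truncate 𝕜 E p R x).1 i = x.1 i :=
  extendZero_val R (fun j : R => x.1 j) ⟨i, hi⟩

theorem truncate_apply_of_notMem {R : Set ι} (x : directSum 𝕜 E p) {i : ι} (hi : i ∉ R) :
    (truncate 𝕜 E p R x).1 i = 0 :=
  extendZero_of_notMem R _ hi

theorem norm_eq_rpow_tsum (hp : 0 < p.toReal) (x : directSum 𝕜 E p) :
    ‖x‖ ^ p.toReal = ∑' i, ‖x.1 i‖ ^ p.toReal :=
  lp.norm_rpow_eq_tsum hp x.1

theorem tendsto_truncate (x : directSum 𝕜 E p) :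
    Tendsto (fun s : Finset ι => truncate 𝕜 E p (s : Set ι) x) atTop (𝓝 x) := by
  classical
  rw [tendsto_iff_norm_sub_tendsto_zero]
  by_cases hp : p = ∞
  · subst hp
    rw [Metric.tendsto_atTop]
    intro δ hδ
    have h : ∀ᶠ i in cofinite, ‖x.1 i‖ < δ / 2 :=
      (tendsto_order.1 (show Tendsto (fun i => ‖x.1 i‖) cofinite (𝓝 0) from x.2)).2 _ (half_pos hδ)
    refine ⟨h.toFinset, fun s hs => ?_⟩
    rw [Real.dist_0_eq_abs, abs_norm]
    refine lt_of_le_of_lt ?_ (half_lt_self hδ)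
    refine lp.norm_le_of_forall_le (E := E)
      (f := (truncate 𝕜 E ∞ (s : Set ι) x - x).1) (half_pos hδ).le fun i => ?_
    change ‖(truncate 𝕜 E ∞ (s : Set ι) x).1 i - x.1 i‖ ≤ δ / 2
    by_cases hi : i ∈ (s : Set ι)
    · rw [truncate_apply_of_mem 𝕜 x hi, sub_self, norm_zero]
      exact (half_pos hδ).le
    · rw [truncate_apply_of_notMem 𝕜 x hi, zero_sub, norm_neg]
      by_contra hcon
      exact hi (hs (h.mem_toFinset.2 fun hlt => hcon (le_of_lt hlt)))
  · have hp0 : 0 < p.toReal :=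
      ENNReal.toReal_pos (zero_lt_one.trans_le (Fact.out : 1 ≤ p)).ne' hp
    have hsum := (lp.memℓp x.1).summable hp0
    have h : ∀ s : Finset ι, ‖truncate 𝕜 E p (s : Set ι) x - x‖ =
        (∑' i : {i // i ∉ s}, ‖x.1 i‖ ^ p.toReal) ^ (p.toReal)⁻¹ := by
      intro s
      rw [← Real.rpow_rpow_inv (norm_nonneg _) hp0.ne', norm_eq_rpow_tsum 𝕜 hp0]
      congr 1
      have h0 : ∀ i, ‖(truncate 𝕜 E p (s : Set ι) x - x).1 i‖ ^ p.toReal =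
          Set.indicator {i | i ∉ s} (fun i => ‖x.1 i‖ ^ p.toReal) i := by
        intro i
        change ‖(truncate 𝕜 E p (s : Set ι) x).1 i - x.1 i‖ ^ p.toReal = _
        by_cases hi : i ∈ s
        · rw [truncate_apply_of_mem 𝕜 x (by simpa using hi), sub_self, norm_zero,
            Real.zero_rpow hp0.ne', Set.indicator_of_notMem (by simpa using hi)]
        · rw [truncate_apply_of_notMem 𝕜 x (by simpa using hi), zero_sub, norm_neg,
            Set.indicator_of_mem (by simpa using hi)]
      simp_rw [h0]
      exact (tsum_subtype {i | i ∉ s} _).symm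
    simp_rw [h]
    have h1 := (tendsto_tsum_compl_atTop_zero fun i => ‖x.1 i‖ ^ p.toReal).rpow_const
      (p := (p.toReal)⁻¹) (Or.inr (by positivity))
    rwa [Real.zero_rpow (by positivity)] at h1

/-- A direct sum with exponent `p > 1` is asymptotically uniformly smooth with respect to the
truncations, with a modulus depending only on `p`. -/
theorem exists_norm_truncate_add_le (hp : 1 < p) {κ : ℝ} (hκ : 0 < κ) :
    ∃ t : ℝ, 0 < t ∧ ∀ (R : Set ι) (u v : directSum 𝕜 E p), ‖u‖ ≤ 1 → ‖v‖ ≤ 1 →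
      ‖truncate 𝕜 E p R u + (t : 𝕜) • (v - truncate 𝕜 E p R v)‖ ≤ 1 + κ * t := by
  -- The two summands have disjoint supports, so each coordinate sees only one of them.
  have hcoord : ∀ (t : ℝ) (ht : 0 < t) (R : Set ι) (u v : directSum 𝕜 E p) (i : ι),
      ‖(truncate 𝕜 E p R u + (t : 𝕜) • (v - truncate 𝕜 E p R v)).1 i‖ = ‖u.1 i‖ ∨
      ‖(truncate 𝕜 E p R u + (t : 𝕜) • (v - truncate 𝕜 E p R v)).1 i‖ = t * ‖v.1 i‖ := by
    intro t ht R u v i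
    change ‖(truncate 𝕜 E p R u).1 i + (t : 𝕜) • (v.1 i - (truncate 𝕜 E p R v).1 i)‖ = _ ∨
      ‖(truncate 𝕜 E p R u).1 i + (t : 𝕜) • (v.1 i - (truncate 𝕜 E p R v).1 i)‖ = _
    by_cases hi : i ∈ R
    · left
      rw [truncate_apply_of_mem 𝕜 u hi, truncate_apply_of_mem 𝕜 v hi, sub_self, smul_zero,
        add_zero]
    · right
      rw [truncate_apply_of_notMem 𝕜 u hi, truncate_apply_of_notMem 𝕜 v hi, sub_zero, zero_add,
        norm_smul, RCLike.norm_ofReal, abs_of_pos ht]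
  by_cases hpt : p = ∞
  · subst hpt
    refine ⟨1, one_pos, fun R u v hu hv => ?_⟩
    refine lp.norm_le_of_forall_le (E := E)
      (f := (truncate 𝕜 E ∞ R u + ((1 : ℝ) : 𝕜) • (v - truncate 𝕜 E ∞ R v)).1)
      (by positivity) fun i => ?_
    have h1 : ‖u.1 i‖ ≤ 1 := (lp.norm_apply_le_norm ENNReal.top_ne_zero u.1 i).trans hu
    have h2 : ‖v.1 i‖ ≤ 1 := (lp.norm_apply_le_norm ENNReal.top_ne_zero v.1 i).trans hv
    rcases hcoord 1 one_pos R u v i with h | h <;> rw [h] <;> linarith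
  · have hq : 1 < p.toReal := by
      rw [← ENNReal.toReal_one]
      exact (ENNReal.toReal_lt_toReal ENNReal.one_ne_top hpt).2 hp
    set q := p.toReal with hqdef
    have hq0 : 0 < q := one_pos.trans hq
    -- This `t` solves `t ^ q = κ * t`, which requires `q > 1`.
    refine ⟨κ ^ (q - 1)⁻¹, by positivity, fun R u v hu hv => ?_⟩
    have ht : 0 < κ ^ (q - 1)⁻¹ := by positivity
    have htq : (κ ^ (q - 1)⁻¹) ^ q = κ * κ ^ (q - 1)⁻¹ := by
      have h1 : (κ ^ (q - 1)⁻¹) ^ (q - 1) = κ := Real.rpow_inv_rpow hκ.le (by linarith)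
      calc (κ ^ (q - 1)⁻¹) ^ q = (κ ^ (q - 1)⁻¹) ^ ((q - 1) + 1) := by ring_nf
        _ = κ * κ ^ (q - 1)⁻¹ := by rw [Real.rpow_add ht, h1, Real.rpow_one]
    set t := κ ^ (q - 1)⁻¹ with htdef
    have hu' : ∑' i, ‖u.1 i‖ ^ q ≤ 1 := by
      rw [← norm_eq_rpow_tsum 𝕜 hq0]
      exact Real.rpow_le_one (norm_nonneg _) hu hq0.le
    have hv' : ∑' i, ‖v.1 i‖ ^ q ≤ 1 := by
      rw [← norm_eq_rpow_tsum 𝕜 hq0]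
      exact Real.rpow_le_one (norm_nonneg _) hv hq0.le
    have hsu := (lp.memℓp u.1).summable hq0
    have hsv := (lp.memℓp v.1).summable hq0
    rw [← Real.rpow_le_rpow_iff (norm_nonneg _) (by positivity) hq0, norm_eq_rpow_tsum 𝕜 hq0]
    calc _ ≤ ∑' i, (‖u.1 i‖ ^ q + t ^ q * ‖v.1 i‖ ^ q) := by
          refine Summable.tsum_le_tsum (fun i => ?_)
            ((lp.memℓp (truncate 𝕜 E p R u + (t : 𝕜) • (v - truncate 𝕜 E p R v)).1).summable hq0)
            (hsu.add (hsv.mul_left _))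
          rcases hcoord t ht R u v i with h | h <;> rw [h]
          · have : 0 ≤ t ^ q * ‖v.1 i‖ ^ q := by positivity
            linarith
          · rw [Real.mul_rpow ht.le (norm_nonneg _)]
            have : 0 ≤ ‖u.1 i‖ ^ q := by positivity
            linarith
      _ = ∑' i, ‖u.1 i‖ ^ q + t ^ q * ∑' i, ‖v.1 i‖ ^ q := by
          rw [hsu.tsum_add (hsv.mul_left _), tsum_mul_left]
      _ ≤ 1 + t ^ q * 1 := by gcongr
      _ = 1 + κ * t := by rw [mul_one, htq]
      _ ≤ (1 + κ * t) ^ q :=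
          Real.self_le_rpow_of_one_le (by nlinarith [mul_pos hκ ht]) hq.le

end Truncation

/-! ### Functionals on direct sums and the exhaustion argument -/

section DirectSumDual

variable {𝕜 : Type*} [RCLike 𝕜] {ι : Type*} {E : ι → Type*}
  [∀ i, NormedAddCommGroup (E i)] [∀ i, NormedSpace 𝕜 (E i)]
  {p : ℝ≥0∞} [Fact (1 ≤ p)] {X : Type*} [NormedAddCommGroup X] [NormedSpace 𝕜 X]

open WeakDual

theorem exists_unit_mul_eq_norm (z : 𝕜) : ∃ c : 𝕜, ‖c‖ ≤ 1 ∧ c * z = (‖z‖ : 𝕜) := by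
  by_cases hz : z = 0
  · exact ⟨0, by simp, by simp [hz]⟩
  · have hz' : (‖z‖ : 𝕜) ≠ 0 := by simpa using hz
    refine ⟨(‖z‖ : 𝕜) / z, ?_, div_mul_cancel₀ _ hz⟩
    rw [norm_div, RCLike.norm_ofReal, abs_norm, div_self (by simpa using hz)]

variable (𝕜 E) in
/-- A functional on a direct sum which almost attains its norm on the families supported in `R` is
uniformly close to its truncation to `R`. -/
theorem exists_dualDist_truncate_le (hp : 1 < p) (r : ℝ) {η : ℝ} (hη : 0 < η) :
    ∃ δ : ℝ, 0 < δ ∧ ∀ a ≤ r, 0 ≤ a → ∀ (R : Set ι) (z : WeakDual 𝕜 (directSum 𝕜 E p))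
      (u : directSum 𝕜 E p), ‖toStrongDual z‖ ≤ a → ‖u‖ ≤ 1 →
      a - δ < ‖z (truncate 𝕜 E p R u)‖ →
      dualDist z (weakAdjoint (truncate 𝕜 E p R) z) ≤ η := by
  -- With this `κ`, `a * κ ≤ η / 2` for every `0 ≤ a ≤ r`. Taking `δ = t * (η / 2)` then leaves
  -- exactly `t * η` for `t` times the value of `z` on the tail.
  have hκ : 0 < η / (2 * (|r| + 1)) := by positivity
  obtain ⟨t, ht, h⟩ := exists_norm_truncate_add_le 𝕜 (E := E) hp hκ
  refine ⟨t * (η / 2), by positivity, fun a har ha R z u hz hu hzu => ?_⟩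
  refine ContinuousLinearMap.opNorm_le_of_unit_norm hη.le fun v hv => ?_
  replace hv := hv.le
  change ‖z v - z (truncate 𝕜 E p R v)‖ ≤ η
  rw [← map_sub]
  -- Rotating `u` and `v` by scalars makes both values of `z` nonnegative reals, so that they add
  -- without cancellation.
  obtain ⟨c, hc, hcz⟩ := exists_unit_mul_eq_norm (z (truncate 𝕜 E p R u))
  obtain ⟨e, he, hez⟩ := exists_unit_mul_eq_norm (z (v - truncate 𝕜 E p R v))
  have hcu : ‖c • u‖ ≤ 1 := by
    rw [norm_smul]
    exact mul_le_one₀ hc (norm_nonneg _) hu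
  have hev : ‖e • v‖ ≤ 1 := by
    rw [norm_smul]
    exact mul_le_one₀ he (norm_nonneg _) hv
  have h1 := h R (c • u) (e • v) hcu hev
  have h2 : z (truncate 𝕜 E p R (c • u) + (t : 𝕜) • (e • v - truncate 𝕜 E p R (e • v))) =
      ((‖z (truncate 𝕜 E p R u)‖ + t * ‖z (v - truncate 𝕜 E p R v)‖ : ℝ) : 𝕜) := by
    rw [map_smul, map_smul, ← smul_sub, map_add, map_smul, map_smul, map_smul, smul_eq_mul,
      smul_eq_mul, smul_eq_mul, hcz, hez]
    push_cast
    rfl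
  have h3 := (toStrongDual z).le_of_opNorm_le hz
    (truncate 𝕜 E p R (c • u) + (t : 𝕜) • (e • v - truncate 𝕜 E p R (e • v)))
  rw [toStrongDual_apply, h2, RCLike.norm_ofReal, abs_of_nonneg (by positivity)] at h3
  have h4 : a * (1 + η / (2 * (|r| + 1)) * t) ≤ a + t * (η / 2) := by
    have h5 : a ≤ |r| + 1 := by linarith [le_abs_self r]
    have h6 : a * (η / (2 * (|r| + 1))) ≤ (|r| + 1) * (η / (2 * (|r| + 1))) := by gcongr
    have h7 : (|r| + 1) * (η / (2 * (|r| + 1))) = η / 2 := by field_simp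
    nlinarith
  have h8 := h3.trans ((mul_le_mul_of_nonneg_left h1 ha).trans h4)
  have h9 : t * ‖z (v - truncate 𝕜 E p R v)‖ ≤ t * η := by linarith
  exact le_of_mul_le_mul_left h9 ht

/-- Finite truncations converge in norm, so a vector at which `x` exceeds `a` may be replaced by a
finite truncation. -/
theorem exists_lt_norm_apply_truncate [Nonempty ι] {a : ℝ} {x : WeakDual 𝕜 (directSum 𝕜 E p)}
    (hx : a < ‖toStrongDual x‖) :
    ∃ (s : Finset ι) (u : directSum 𝕜 E p), s.Nonempty ∧ ‖u‖ ≤ 1 ∧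
      a < ‖x (truncate 𝕜 E p (s : Set ι) u)‖ := by
  obtain ⟨u, hu, hxu⟩ : ∃ u : directSum 𝕜 E p, ‖u‖ ≤ 1 ∧ a < ‖x u‖ := by
    by_contra! hcon
    have ha : 0 ≤ a := (norm_nonneg _).trans (hcon 0 (by simp))
    exact hx.not_ge (ContinuousLinearMap.opNorm_le_of_unit_norm ha fun v hv => hcon v hv.le)
  have h : Tendsto (fun s : Finset ι => ‖x (truncate 𝕜 E p (s : Set ι) u)‖) atTop (𝓝 ‖x u‖) :=
    (((toStrongDual x).continuous.tendsto u).comp (tendsto_truncate 𝕜 u)).norm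
  obtain ⟨s, hs, hs'⟩ := ((h.eventually (lt_mem_nhds hxu)).and
    (eventually_ge_atTop {Classical.arbitrary ι})).exists
  exact ⟨s, u, ⟨_, hs' (Finset.mem_singleton_self _)⟩, hu, hs⟩

/-- Replacing `z` and `w` by their images under `P*` changes the pulled-back distance by at most `2
* ‖T‖ * η ≤ ε`, so a separation above `2 * ε` stays above `ε`. -/
theorem derivedIter_weakAdjoint_inter_subset {Y : Type*} [NormedAddCommGroup Y] [NormedSpace 𝕜 Y]
    (T : X →L[𝕜] Y) (P : Y →L[𝕜] Y) {η ε : ℝ} (hη : 2 * ‖T‖ * η ≤ ε) {L V : Set (WeakDual 𝕜 Y)}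
    (hV : IsOpen V) (hP : ∀ z ∈ L ∩ V, dualDist z (weakAdjoint P z) ≤ η) (β : Ordinal) :
    derivedIter (fun z w => dualDist (weakAdjoint T z) (weakAdjoint T w)) (2 * ε) L β ∩ V ⊆
      derivedIter (fun z w => dualDist (weakAdjoint (P ∘L T) z) (weakAdjoint (P ∘L T) w)) ε L β := by
  refine derivedIter_inter_subset hV Set.inter_subset_left (fun z hz w hw hzw => ?_) β
  have hclose : ∀ z ∈ L ∩ V,
      dualDist (weakAdjoint T z) (weakAdjoint (P ∘L T) z) ≤ ‖T‖ * η := fun z hz =>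
    (dualDist_weakAdjoint_le T z (weakAdjoint P z)).trans
      (mul_le_mul_of_nonneg_left (hP z hz) (norm_nonneg _))
  have h1 := hclose z hz
  have h2 := hclose w hw
  rw [dualDist_comm] at h2
  linarith [dualDist_triangle (weakAdjoint T z) (weakAdjoint (P ∘L T) z) (weakAdjoint T w),
    dualDist_triangle (weakAdjoint (P ∘L T) z) (weakAdjoint (P ∘L T) w) (weakAdjoint T w)]

/-- A survivor of norm above `a - δ` would lie in a weak-star open set on which all functionals of
`L` are close to their truncations to one finite `s`; there it would also survive the derivation
truncated to `s`, which is already empty. -/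
theorem norm_le_of_mem_derivedIter [Nonempty ι] (T : X →L[𝕜] directSum 𝕜 E p) {a δ η ε : ℝ}
    (hη : 2 * ‖T‖ * η ≤ ε)
    (hδ : ∀ (R : Set ι) (z : WeakDual 𝕜 (directSum 𝕜 E p)) (u : directSum 𝕜 E p),
      ‖toStrongDual z‖ ≤ a → ‖u‖ ≤ 1 → a - δ < ‖z (truncate 𝕜 E p R u)‖ →
      dualDist z (weakAdjoint (truncate 𝕜 E p R) z) ≤ η)
    {L : Set (WeakDual 𝕜 (directSum 𝕜 E p))} (hL : ∀ z ∈ L, ‖toStrongDual z‖ ≤ a) {β : Ordinal}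
    (hβ : ∀ s : Finset ι, s.Nonempty → derivedIter (fun z w =>
      dualDist (weakAdjoint (truncate 𝕜 E p (s : Set ι) ∘L T) z)
        (weakAdjoint (truncate 𝕜 E p (s : Set ι) ∘L T) w)) ε L β = ∅)
    {x : WeakDual 𝕜 (directSum 𝕜 E p)}
    (hx : x ∈ derivedIter (fun z w => dualDist (weakAdjoint T z) (weakAdjoint T w)) (2 * ε) L β) :
    ‖toStrongDual x‖ ≤ a - δ := by
  by_contra! hcon
  obtain ⟨s, u, hs, hu, hxu⟩ := exists_lt_norm_apply_truncate hcon
  have hV : IsOpen {z : WeakDual 𝕜 (directSum 𝕜 E p) |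
      a - δ < ‖z (truncate 𝕜 E p (s : Set ι) u)‖} :=
    isOpen_lt continuous_const (WeakDual.eval_continuous _).norm
  have hsub := derivedIter_weakAdjoint_inter_subset T (truncate 𝕜 E p (s : Set ι)) hη hV
    (fun z hz => hδ s z u (hL z hz.1) hu hz.2) β
  rw [hβ s hs] at hsub
  exact hsub ⟨hx, hxu⟩

/-- If, for every finite set of coordinates, the derivations after truncation exhaust `L` in `β`
steps, then the derivations without truncation exhaust `L` in `β * n` steps, where `n` depends
neither on `L` nor on `β`. -/
theorem exists_derivedIter_mul_eq_empty (hp : 1 < p) (T : X →L[𝕜] directSum 𝕜 E p) (r : ℝ)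
    {ε : ℝ} (hε : 0 < ε) :
    ∃ n : ℕ, ∀ (L : Set (WeakDual 𝕜 (directSum 𝕜 E p))) (β : Ordinal),
      (∀ z ∈ L, ‖toStrongDual z‖ ≤ r) → 1 ≤ β →
      (∀ s : Finset ι, s.Nonempty → derivedIter (fun z w =>
        dualDist (weakAdjoint (truncate 𝕜 E p (s : Set ι) ∘L T) z)
          (weakAdjoint (truncate 𝕜 E p (s : Set ι) ∘L T) w)) ε L β = ∅) →
      derivedIter (fun z w => dualDist (weakAdjoint T z) (weakAdjoint T w)) (2 * ε) L
        (β * (n : Ordinal)) = ∅ := by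
  rcases isEmpty_or_nonempty ι with hι | hι
  -- Without indices the hypothesis on `s` is vacuous, but the space is trivial and a single
  -- derivation empties any set; this is where `1 ≤ β` is needed.
  · refine ⟨1, fun L β _ hβ _ => ?_⟩
    have hsub : Subsingleton (directSum 𝕜 E p) :=
      ⟨fun x y => Subtype.ext (lp.ext (funext fun i => isEmptyElim i))⟩
    rw [Nat.cast_one, mul_one]
    refine Set.subset_eq_empty (derivedIter_antitone _ _ _ hβ) ?_
    rw [← zero_add (1 : Ordinal), derivedIter_add_one, Set.eq_empty_iff_forall_notMem]
    rintro x ⟨-, hx⟩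
    obtain ⟨z, -, w, -, hzw⟩ := hx Set.univ isOpen_univ (Set.mem_univ x)
    have hzw' : z = w := DFunLike.ext z w fun v => by rw [Subsingleton.elim v 0, map_zero, map_zero]
    simp only [hzw', dualDist_self] at hzw
    linarith
  · have hη : 0 < ε / (2 * (‖T‖ + 1)) := by positivity
    have hη' : 2 * ‖T‖ * (ε / (2 * (‖T‖ + 1))) ≤ ε := by
      rw [mul_div_assoc', div_le_iff₀ (by positivity)]
      nlinarith
    obtain ⟨δ, hδ, h⟩ := exists_dualDist_truncate_le 𝕜 E hp r hη
    obtain ⟨n, hn⟩ := exists_nat_gt (r / δ)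
    rw [div_lt_iff₀ hδ] at hn
    refine ⟨n, fun L β hL _ hβ => ?_⟩
    -- Each block of `β` derivations lowers the norm bound by the same `δ`; after `n > r / δ` blocks
    -- the bound is negative.
    have key : ∀ k : ℕ, ∀ z ∈ derivedIter
        (fun z w => dualDist (weakAdjoint T z) (weakAdjoint T w)) (2 * ε) L (β * (k : Ordinal)),
        ‖toStrongDual z‖ ≤ r - k * δ := by
      intro k
      induction k with
      | zero => simpa [derivedIter_zero] using hL
      | succ k ih =>
        intro z hz
        rw [Nat.cast_succ, mul_add, mul_one, derivedIter_add] at hz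
        -- The current radius is nonnegative because a functional still survives.
        have ha := le_trans (ContinuousLinearMap.opNorm_nonneg _) (ih z (derivedIter_subset _ _ _ _ hz))
        have hkδ : 0 ≤ k * δ := by positivity
        have := norm_le_of_mem_derivedIter T hη'
          (fun R z u hz' => h _ (by linarith) ha R z u hz') ih
          (fun s hs => Set.subset_eq_empty (derivedIter_subset_of_le
            (derivedIter_subset _ _ _ _) (fun _ _ _ _ h => h) β) (hβ s hs)) hz
        push_cast
        linarith
    refine Set.eq_empty_iff_forall_notMem.2 fun z hz => ?_
    linarith [key n z hz, ContinuousLinearMap.opNorm_nonneg (toStrongDual z)]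

universe v in
/-- Bounds for the Szlenk indices of the restrictions of an operator to finite subsums give a bound
for the index of the operator. -/
theorem exists_opEpsIndex_le_of_comp_inj (hp : 1 < p) (r : ℝ) {ε : ℝ} (hε : 0 < ε) :
    ∃ n : ℕ, ∀ (X : Type v) [NormedAddCommGroup X] [NormedSpace 𝕜 X]
      (T : directSum 𝕜 E p →L[𝕜] X) (β : Ordinal), ‖T‖ ≤ r → 1 ≤ β →
      (∀ s : Finset ι, s.Nonempty →
        opEpsIndex ε (T ∘L inj 𝕜 E p (s : Set ι)) ≤ (β : WithTop Ordinal)) →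
      opEpsIndex (2 * ε) T ≤ ((β * (n : Ordinal) : Ordinal) : WithTop Ordinal) := by
  -- The adjoint ball already lies in the dual of the direct sum, so the identity takes the role of
  -- the operator and `T` enters only through the radius `r`. Hence `n` serves all operators of norm
  -- at most `r`.
  obtain ⟨n, hn⟩ := exists_derivedIter_mul_eq_empty hp
    (ContinuousLinearMap.id 𝕜 (directSum 𝕜 E p)) r hε
  refine ⟨n, fun X _ _ T β hT hβ h => ?_⟩
  rw [opEpsIndex_le_iff (by positivity)]
  refine hn _ β ?_ hβ fun s hs => ?_
  · rintro _ ⟨f, hf, rfl⟩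
    rw [mem_dualBall] at hf
    refine ((toStrongDual f).opNorm_comp_le T).trans ?_
    exact (mul_le_of_le_one_left (ContinuousLinearMap.opNorm_nonneg _) hf).trans hT
  · have h1 := (opEpsIndex_le_iff hε.le _ _).1 (h s hs)
    have h2 := mapsTo_derivedIter (ε := ε) (continuous_weakAdjoint (inj 𝕜 E p (s : Set ι)))
      (e := dualDist) (Set.mapsTo_image _ (weakAdjoint T '' dualBall 𝕜 X)) β
    rw [← weakAdjoint_image_comp, h1] at h2
    rw [← Set.mapsTo_empty_iff (f := weakAdjoint (inj 𝕜 E p (s : Set ι)))]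
    refine h2.mono_left (derivedIter_subset_of_le subset_rfl (fun z _ w _ hzw => ?_) β)
    refine hzw.trans_le ?_
    -- The adjoint of the truncation factors as restriction to the subsum followed by the
    -- contraction `proj*`.
    refine (dualDist_weakAdjoint_le (proj 𝕜 E p (s : Set ι)) (weakAdjoint (inj 𝕜 E p (s : Set ι)) z)
      (weakAdjoint (inj 𝕜 E p (s : Set ι)) w)).trans ?_
    exact mul_le_of_le_one_left (dualDist_nonneg _ _) (norm_proj_le 𝕜 E p _)

/-- Bounds for the Szlenk indices of the compositions of an operator with the projections onto
finite subsums give a bound for the index of the operator. -/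
theorem exists_opEpsIndex_le_of_proj_comp (hp : 1 < p) (T : X →L[𝕜] directSum 𝕜 E p)
    {ε : ℝ} (hε : 0 < ε) :
    ∃ n : ℕ, ∀ β : Ordinal, 1 ≤ β →
      (∀ s : Finset ι, s.Nonempty →
        opEpsIndex ε (proj 𝕜 E p (s : Set ι) ∘L T) ≤ (β : WithTop Ordinal)) →
      opEpsIndex (2 * (2 * ε)) T ≤ ((β * (n : Ordinal) : Ordinal) : WithTop Ordinal) := by
  obtain ⟨n, hn⟩ := exists_derivedIter_mul_eq_empty hp T 1 hε
  refine ⟨n, fun β hβ h => ?_⟩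
  rw [opEpsIndex_le_iff (by positivity)]
  -- The derivation is lifted to the dual ball with the distance pulled back by `T*`. This costs one
  -- factor 2, the truncation argument the other.
  refine Set.subset_eq_empty (derivedIter_image_subset (continuous_weakAdjoint T)
    dualDist_comm dualDist_triangle isCompact_dualBall isCompact_dualBall.isClosed _) ?_
  rw [Set.image_eq_empty]
  refine hn _ β (fun z hz => mem_dualBall.1 hz) hβ fun s hs => ?_
  have h1 := (opEpsIndex_le_iff hε.le _ _).1 (h s hs)
  have hmaps : Set.MapsTo (weakAdjoint (truncate 𝕜 E p (s : Set ι) ∘L T))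
      (dualBall 𝕜 (directSum 𝕜 E p))
      (weakAdjoint (proj 𝕜 E p (s : Set ι) ∘L T) '' dualBall 𝕜 _) := by
    intro z hz
    refine ⟨weakAdjoint (inj 𝕜 E p (s : Set ι)) z, ?_, rfl⟩
    rw [mem_dualBall] at hz ⊢
    exact (ContinuousLinearMap.opNorm_comp_le _ _).trans
      (mul_le_one₀ hz (ContinuousLinearMap.opNorm_nonneg _) (norm_inj_le 𝕜 E p _))
  have h2 := mapsTo_derivedIter (ε := ε) (continuous_weakAdjoint _) (e := dualDist) hmaps β
  rwa [h1, Set.mapsTo_empty_iff] at h2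

end DirectSumDual

end Szlenk

/-! ### The equivalence -/

theorem proposition3p2 {𝕜 : Type*} [RCLike 𝕜] {Λ Υ : Type*}
    {E : Λ → Type*} [∀ l, NormedAddCommGroup (E l)] [∀ l, NormedSpace 𝕜 (E l)]
    [∀ l, CompleteSpace (E l)]
    {F : Υ → Type*} [∀ u, NormedAddCommGroup (F u)] [∀ u, NormedSpace 𝕜 (F u)]
    [∀ u, CompleteSpace (F u)]
    (p : ℝ≥0∞) [Fact (1 ≤ p)] (hp : 1 < p)
    (T : Szlenk.directSum 𝕜 E p →L[𝕜] Szlenk.directSum 𝕜 F p)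
    (α : Ordinal) (hα : 0 < α) :
    List.TFAE [
      Szlenk.opIndex T ≤ ((Ordinal.omega0 ^ α : Ordinal) : WithTop Ordinal),
      ∀ ε : ℝ, 0 < ε →
        (⨆ A : {A : Finset Λ // A.Nonempty},
          Szlenk.opEpsIndex ε (T ∘L Szlenk.inj 𝕜 E p (A.1 : Set Λ))) <
        ((Ordinal.omega0 ^ α : Ordinal) : WithTop Ordinal),
      ∀ ε : ℝ, 0 < ε →
        (⨆ B : {B : Finset Υ // B.Nonempty},
          Szlenk.opEpsIndex ε (Szlenk.proj 𝕜 F p (B.1 : Set Υ) ∘L T)) <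
        ((Ordinal.omega0 ^ α : Ordinal) : WithTop Ordinal),
      ∀ ε : ℝ, 0 < ε →
        (⨆ (A : {A : Finset Λ // A.Nonempty}) (B : {B : Finset Υ // B.Nonempty}),
          Szlenk.opEpsIndex ε
            (Szlenk.proj 𝕜 F p (B.1 : Set Υ) ∘L T ∘L Szlenk.inj 𝕜 E p (A.1 : Set Λ))) <
        ((Ordinal.omega0 ^ α : Ordinal) : WithTop Ordinal)] := by
  have hlim : Order.IsSuccLimit (Ordinal.omega0 ^ α) :=
    Ordinal.isSuccLimit_opow_left Ordinal.isSuccLimit_omega0 hα.ne'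
  -- The maximum with `1` meets the condition `1 ≤ β` of the exhaustion lemmas and stays below `ω ^
  -- α` since `α > 0`.
  have hmul : ∀ β < Ordinal.omega0 ^ α, ∀ n : ℕ,
      (((max β 1) * (n : Ordinal) : Ordinal) : WithTop Ordinal) <
        ((Ordinal.omega0 ^ α : Ordinal) : WithTop Ordinal) := fun β hβ n =>
    WithTop.coe_lt_coe.2 (Ordinal.mul_lt_omega0_opow hα
      (max_lt hβ (Ordinal.one_lt_opow.2 ⟨Ordinal.one_lt_omega0, hα.ne'⟩)) (Ordinal.natCast_lt_omega0 n))
  have hmax : ∀ β : Ordinal, (β : WithTop Ordinal) ≤ ((max β 1 : Ordinal) : WithTop Ordinal) :=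
    fun β => WithTop.coe_le_coe.2 (le_max_left _ _)
  tfae_have 1 → 2 := by
    intro h ε hε
    refine (iSup_le fun A => ?_).trans_lt
      (Szlenk.opEpsIndex_lt_of_opIndex_le (half_pos hε) T hlim h)
    simpa only [mul_div_cancel₀ ε (two_ne_zero' ℝ)] using
      Szlenk.opEpsIndex_comp_right_le (half_pos hε).le T _ (Szlenk.norm_inj_le 𝕜 E p A.1)
  tfae_have 2 → 4 := by
    intro h ε hε
    refine (iSup_mono fun A => iSup_le fun B => ?_).trans_lt (h ε hε)
    exact Szlenk.opEpsIndex_comp_left_le hε.le _ _ (Szlenk.norm_proj_le 𝕜 F p B.1)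
  tfae_have 4 → 3 := by
    intro h ε hε
    obtain ⟨β, hβ, hβα⟩ := WithTop.lt_iff_exists_coe.1 (h (ε / 2) (half_pos hε))
    rw [WithTop.coe_lt_coe] at hβα
    -- One `n` works for every `B`, because all the operators `Q_B T` have norm at most `‖T‖`; this
    -- keeps the supremum over `B` strictly below `ω ^ α`.
    obtain ⟨n, hn⟩ := Szlenk.exists_opEpsIndex_le_of_comp_inj (𝕜 := 𝕜) (E := E) hp ‖T‖
      (half_pos hε)
    refine (iSup_le fun B => ?_).trans_lt (hmul β hβα n)
    have h1 := hn _ (Szlenk.proj 𝕜 F p (B.1 : Set Υ) ∘L T) (max β 1)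
      ((ContinuousLinearMap.opNorm_comp_le _ _).trans
        (mul_le_of_le_one_left (ContinuousLinearMap.opNorm_nonneg _)
          (Szlenk.norm_proj_le 𝕜 F p B.1))) (le_max_right _ _)
      fun s hs => ((le_iSup₂ (f := fun (A : {A : Finset Λ // A.Nonempty})
        (B : {B : Finset Υ // B.Nonempty}) => Szlenk.opEpsIndex (ε / 2)
          (Szlenk.proj 𝕜 F p (B.1 : Set Υ) ∘L T ∘L Szlenk.inj 𝕜 E p (A.1 : Set Λ)))
          ⟨s, hs⟩ B).trans_eq hβ).trans (hmax β)
    rwa [mul_div_cancel₀ ε (two_ne_zero' ℝ)] at h1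
  tfae_have 3 → 1 := by
    intro h
    refine iSup₂_le fun ε hε => ?_
    have hε4 : 0 < ε / 4 := by positivity
    obtain ⟨β, hβ, hβα⟩ := WithTop.lt_iff_exists_coe.1 (h (ε / 4) hε4)
    rw [WithTop.coe_lt_coe] at hβα
    obtain ⟨n, hn⟩ := Szlenk.exists_opEpsIndex_le_of_proj_comp hp T hε4
    have h1 := hn (max β 1) (le_max_right _ _) fun s hs =>
      ((le_iSup (fun B : {B : Finset Υ // B.Nonempty} => Szlenk.opEpsIndex (ε / 4)
        (Szlenk.proj 𝕜 F p (B.1 : Set Υ) ∘L T)) ⟨s, hs⟩).trans_eq hβ).trans (hmax β)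
    rw [show 2 * (2 * (ε / 4)) = ε by ring] at h1
    exact h1.trans (hmul β hβα n).le
  tfae_finish
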